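/- For $\ell\in\mathbb{N}$, let $K^\ell$ be the following two-player impartial game. Positions are pairs $(x,y)\in\mathbb{N}^2$. The terminal positions are those with $x+y\le \ell$; no move is possible from them. From a non-terminal position, a move removes a positive number of tokens from one coordinate, or the same positive number from both coordinates (Wythoff's moves). A player who is unable to move loses. A position is a $\mathcal{P}$-position if none of its options is a $\mathcal{P}$-position; in particular, all terminal positions are $\mathcal{P}$-positions. Let $F_0=1$, $F_1=2$, $F_{i+2}=F_{i+1}+F_i$. The Fibonacci representation $\mathrm{rep}_F(n)$ of $n\ge 0$ is the unique word $d_k\cdots d_0$ over $\{0,1\}$ with $n=\sum_{i=0}^k d_iF_i$, with no factor $11$ and with no leading $0$ (so $\mathrm{rep}_F(0)$ is the empty word). A function $g$ on $\mathbb{N}$ is Fibonacci-automatic if there is a deterministic finite automaton with output that, for every $n\ge 0$, outputs $g(n)$ after reading $\mathrm{rep}_F(n)$ from left to right. For a word $u$ over $\{0,1\}$ and an infinite word $w=w_0w_1w_2\cdots$, write $w_u$ for the letter of $w$ whose index is the value of $u$ in the system $(F_i)$. A morphism $\mu:A^*\to A^*$ is a $\varphi$-morphism if it has an infinite fixed point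 and if, for each of its infinite fixed points $w$ and each $n\ge 0$ with $u=\mathrm{rep}_F(n)$, we have $\mu(w_n)=w_{u0}$ when $u$ ends with $1$ and $\mu(w_n)=w_{u0}w_{u1}$ otherwise. Let $\mu_3$ be the morphism over the $12$-letter alphabet $\{0,1,\ldots,9,\mathtt{a},\mathtt{b}\}$ given by \[ 0\mapsto 01,\; 1\mapsto 2,\; 2\mapsto 34,\; 3\mapsto 56,\; 4\mapsto 7,\; 5\mapsto 78,\; 6\mapsto 9,\; 7\mapsto \mathtt{ab},\; 8\mapsto \mathtt{a},\; 9\mapsto 56,\; \mathtt{a}\mapsto \mathtt{ab},\; \mathtt{b}\mapsto 7, \] and let $\rho_3$ be the coding \[ 0,3,5,6,8,\mathtt{a},\mathtt{b}\mapsto 1,\qquad 1,2,7,9\mapsto 2,\qquad 4\mapsto 0 . \] **Theorem.** The morphism $\mu_3$ is a $\varphi$-morphism, and $\mu_3^\omega(0)=\lim_{k\to\infty}\mu_3^k(0)$ is an infinite fixed point of it. Let $g_3:\mathbb{N}\to\{0,1,2\}$ be the function such that $g_3(n)$ is the letter with index $n$ (indices start at $0$) of $\rho_3(\mu_3^\omega(0))$.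 Then $g_3$ is Fibonacci-automatic. Moreover, there are strictly increasing sequences $(a_n)_{n\ge 0}$ and $(b_n)_{n\ge 0}$ of natural numbers with $a_n<b_n$ such that the non-terminal $\mathcal{P}$-positions of $K^3$ are exactly the pairs $(a_n,b_n)$ and $(b_n,a_n)$ with $n\ge 0$, and for all $n\ge 0$ \[ a_n=\lfloor (n+2)\phi\rfloor+g_3(n+1)-1\quad\text{and}\quad b_n=\lfloor (n+2)\phi^2\rfloor+g_3(n+1)+1, \] where $\phi=(1+\sqrt5)/2$ is the golden ratio. -/

import Mathlib

/-! ### The games `K^ℓ` -/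

/-- The terminal positions of `K^ℓ`: the pairs `(x, y)` with `x + y ≤ ℓ`. -/
def IsTerminal (ℓ : ℕ) (p : ℕ × ℕ) : Prop := p.1 + p.2 ≤ ℓ

/-- Wythoff's moves: remove `k > 0` tokens from one pile, or `k > 0` tokens from both piles. -/
def WythoffMove (p q : ℕ × ℕ) : Prop :=
  ∃ k : ℕ, 0 < k ∧
    ((q.1 + k = p.1 ∧ q.2 = p.2) ∨ (q.1 = p.1 ∧ q.2 + k = p.2) ∨ (q.1 + k = p.1 ∧ q.2 + k = p.2))

/-- The moves of `K^ℓ`: Wythoff's moves, played from a non-terminal position. -/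
def KMove (ℓ : ℕ) (p q : ℕ × ℕ) : Prop := ¬ IsTerminal ℓ p ∧ WythoffMove p q

theorem KMove.sum_lt {ℓ : ℕ} {p q : ℕ × ℕ} (h : KMove ℓ p q) : q.1 + q.2 < p.1 + p.2 := by
  obtain ⟨-, k, hk, h⟩ := h
  omega

/-- The `P`-positions of `K^ℓ` (a player who is unable to move loses): a position is a
`P`-position exactly when none of its options is a `P`-position. In particular the terminal
positions are `P`-positions. -/
def IsPPosition (ℓ : ℕ) (p : ℕ × ℕ) : Prop :=
  ∀ q : ℕ × ℕ, KMove ℓ p q → ¬ IsPPosition ℓ q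
termination_by p.1 + p.2
decreasing_by exact KMove.sum_lt ‹_›

/-- `(a n, b n)`, `n ≥ 0`, is the increasing enumeration of the non-terminal `P`-positions of
`K^ℓ`, listed up to the symmetry `(x, y) ↔ (y, x)` with the smaller coordinate first. -/
def EnumeratesNonterminalPPositions (ℓ : ℕ) (a b : ℕ → ℕ) : Prop :=
  StrictMono a ∧ StrictMono b ∧ (∀ n, a n < b n) ∧
    ∀ x y : ℕ, (IsPPosition ℓ (x, y) ∧ ¬ IsTerminal ℓ (x, y)) ↔
      ∃ n, (x = a n ∧ y = b n) ∨ (x = b n ∧ y = a n)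

/-! ### Fibonacci representations and Fibonacci-automatic functions -/

/-- The value of a word `d_k ⋯ d_0` over `{0, 1}`, most significant digit first: the sum of the
`d_i F_i`, where `F_0 = 1`, `F_1 = 2`, `F_{i+2} = F_{i+1} + F_i`, that is `F_i = Nat.fib (i + 2)`. -/
def fibVal : List (Fin 2) → ℕ
  | [] => 0
  | d :: u => (d : ℕ) * Nat.fib (u.length + 2) + fibVal u

/-- `IsFibRep n u`: the word `u` is the Fibonacci representation of `n`, i.e. it has value `n`,
no leading `0`, and no factor `11`. The representation of `0` is the empty word. -/
def IsFibRep (n : ℕ) (u : List (Fin 2)) : Prop :=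
  fibVal u = n ∧ u.head? ≠ some 0 ∧ u.IsChain (fun d e => ¬ (d = 1 ∧ e = 1))

/-- A deterministic finite automaton with output, reading words over `{0, 1}`. -/
structure DFAO (B : Type) where
  State : Type
  finite : Finite State
  start : State
  step : State → Fin 2 → State
  out : State → B

/-- The output of the automaton on a word, read from left to right. -/
def DFAO.output {B : Type} (M : DFAO B) (u : List (Fin 2)) : B :=
  M.out (u.foldl M.step M.start)

/-- `g` is Fibonacci-automatic: `g n` is the output of some DFAO fed with the Fibonacci
representation of `n`. -/
def IsFibonacciAutomatic {B : Type} (g : ℕ → B) : Prop :=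
  ∃ M : DFAO B, ∀ (n : ℕ) (u : List (Fin 2)), IsFibRep n u → M.output u = g n

/-! ### Morphisms; a morphism `μ` of the free monoid on `A` is given by the images of letters -/

/-- `u` is a prefix of the infinite word `w`. -/
def IsPrefixOfWord {A : Type} (u : List A) (w : ℕ → A) : Prop :=
  u = (List.range u.length).map w

/-- The infinite word `w` is a fixed point of `μ`: the images of its prefixes are prefixes of `w`
of unbounded length. -/
def IsFixedPoint {A : Type} (μ : A → List A) (w : ℕ → A) : Prop :=
  (∀ n, IsPrefixOfWord (((List.range n).map w).flatMap μ) w) ∧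
    ∀ m, ∃ n, m ≤ (((List.range n).map w).flatMap μ).length

/-- `μ^k(c)`. -/
def iterMorphism {A : Type} (μ : A → List A) (k : ℕ) (c : A) : List A :=
  (fun u => u.flatMap μ)^[k] [c]

/-- The infinite word `μ^ω(c)`, the limit of the words `μ^k(c)`, for a non-erasing morphism such
that `c` is a proper prefix of `μ(c)`. In this case each `μ^k(c)` is a prefix of the next one and
has more than `k` letters, so the letter with index `n` is the one of `μ^n(c)`. -/
def omegaWord {A : Type} (μ : A → List A) (c : A) (n : ℕ) : A :=
  (iterMorphism μ n c).getD n c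

/-- `μ` is a `φ`-morphism: it has an infinite fixed point and, for every such fixed point `w` and
all `n` with Fibonacci representation `u`, `μ(w_n) = w_{u0}` if `u` ends with `1`, and
`μ(w_n) = w_{u0} w_{u1}` otherwise (for `n = 0` this reads `μ(w_0) = w_0 w_1`). -/
def IsPhiMorphism {A : Type} (μ : A → List A) : Prop :=
  (∃ w : ℕ → A, IsFixedPoint μ w) ∧
    ∀ w : ℕ → A, IsFixedPoint μ w → ∀ (n : ℕ) (u : List (Fin 2)), IsFibRep n u →
      (u.getLast? = some 1 → μ (w n) = [w (fibVal (u ++ [0]))]) ∧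
      (u.getLast? ≠ some 1 → μ (w n) = [w (fibVal (u ++ [0])), w (fibVal (u ++ [1]))])

/-- The morphism `μ_3` over `{0, …, 9, a, b}`, with `a = 10` and `b = 11`. -/
def mu3 : Fin 12 → List (Fin 12) :=
  ![[0, 1], [2], [3, 4], [5, 6], [7], [7, 8], [9], [10, 11], [10], [5, 6], [10, 11], [7]]

/-- The coding `ρ_3`. -/
def rho3 : Fin 12 → Fin 3 :=
  ![1, 2, 2, 1, 0, 1, 1, 2, 1, 2, 1, 1]

/-!
Let `w = μ₃^ω(0)`, `g m = ρ₃ (w m)`, and let `s m` (`imageIndex`) be the length of the image under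
`μ₃` of the prefix of length `m` of `w`, which is the index in `w` where the image of the letter
`w m` starts.

The images under `μ₃` have one or two letters; their first letters have images of length two and
their second letters have images of length one. Hence, in any fixed point, `s (s m) = s m + m`, and
every index is `s j` or `s j + 1` for some `j`. Induction along this structure gives
`s m + 1 = ⌊(m + 1) φ⌋` (`IsFixedPoint.floor_mul_goldenRatio`). Induction on words shows that `s`
appends the digit `0` to Fibonacci representations (`IsFixedPoint.imageIndex_fibVal`), so `μ₃` is a
`φ`-morphism and the automaton whose transitions follow `μ₃` computes `w`.

With `m = n + 1` the asserted formulas become `a n = A m` and `b n = B m`, where `A m = s m + g m`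
and `B m = A m + m + 3`. By Wythoff's classical argument, these pairs are the non-terminal
`P`-positions of `K³` as soon as `A` and `B`, for `m > 0`, increase and split `{4, 5, …}` between
them (`enumeratesNonterminalPPositions_of_complementary`). Complementarity is a local property: the
positions of `B m`, `B (m + 1)` and of the terms of `A` around them, relative to `s (s m)`, depend
only on the letters `w m`, `w (m + 1)`, `w (m + 2)` and their images under `μ₃`. At positive
indices only the twenty factors in `mu3Factors` occur, since that set contains the first one and is
closed under passing to images, and `lowerCoord_local` checks them all.
-/

/-! ### The games `K^ℓ` and complementary sequences -/

/-- A set of positions that is independent and absorbing for the moves is the set of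
`P`-positions. -/
theorem isPPosition_iff_of_kernel {ℓ : ℕ} {Q : ℕ × ℕ → Prop}
    (hind : ∀ p q, Q p → KMove ℓ p q → ¬ Q q)
    (habs : ∀ p, ¬ Q p → ∃ q, KMove ℓ p q ∧ Q q) (p : ℕ × ℕ) :
    IsPPosition ℓ p ↔ Q p := by
  induction hN : p.1 + p.2 using Nat.strong_induction_on generalizing p with
  | _ N ih =>
    subst hN
    rw [IsPPosition]
    constructor
    · intro h
      by_contra hp
      obtain ⟨q, hq, hQ⟩ := habs p hp
      exact h q hq ((ih _ hq.sum_lt q rfl).2 hQ)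
    · intro hp q hq hP
      exact hind p q hp hq ((ih _ hq.sum_lt q rfl).1 hP)

/-- Wythoff's argument: if `a` and `b` are increasing, split `{ℓ + 1, ℓ + 2, …}` between them, and
`b n - a n` runs through `ℓ + 1, ℓ + 2, …`, then the pairs `(a n, b n)` are the non-terminal
`P`-positions. The terminal positions attack the lines with a coordinate at most `ℓ` and the
diagonals with difference at most `ℓ`. -/
theorem enumeratesNonterminalPPositions_of_complementary {ℓ : ℕ} {a b : ℕ → ℕ}
    (ha : StrictMono a) (hb : ∀ n, b n = a n + n + ℓ + 1) (ha0 : ℓ + 1 ≤ a 0)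
    (hdisj : ∀ m n, a m ≠ b n)
    (hcover : ∀ k, ℓ + 1 ≤ k → (∃ n, k = a n) ∨ ∃ n, k = b n) :
    EnumeratesNonterminalPPositions ℓ a b := by
  have hge : ∀ n, ℓ + 1 ≤ a n := fun n => ha0.trans (ha.monotone (Nat.zero_le n))
  have hbmono : StrictMono b := fun m n h => by
    have := ha h
    rw [hb, hb]
    omega
  set R : ℕ → ℕ → Prop := fun x y => ∃ n, (x = a n ∧ y = b n) ∨ (x = b n ∧ y = a n) with hR
  have hRsymm : ∀ x y, R x y → R y x := by
    rintro x y ⟨n, h⟩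
    exact ⟨n, by tauto⟩
  have hRnot : ∀ x y, R x y → ¬ IsTerminal ℓ (x, y) := by
    rintro x y ⟨n, h⟩ ht
    have := hge n
    have := hb n
    simp only [IsTerminal] at ht
    omega
  have key : ∀ p, IsPPosition ℓ p ↔ IsTerminal ℓ p ∨ R p.1 p.2 := by
    apply isPPosition_iff_of_kernel
    · rintro ⟨x, y⟩ ⟨x', y'⟩ hp ⟨hnt, k, hk, hmove⟩ hq
      obtain ⟨n, hn⟩ := hp.resolve_left hnt
      have := hge n
      have := hb n
      simp only at hmove hn
      rcases hq with ht | ⟨m, hm⟩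
      · simp only [IsTerminal] at ht
        omega
      · have := hb m
        simp only at hm
        have h1 : a m = a n → m = n := fun h => ha.injective h
        have h2 : b m = b n → m = n := fun h => hbmono.injective h
        have h3 : m = n → a m = a n := fun h => by rw [h]
        have h4 := hdisj m n
        have h5 := hdisj n m
        omega
    · -- by symmetry it suffices to treat the positions `(x, y)` with `x ≤ y`
      have hle : ∀ x y, x ≤ y → ¬ IsTerminal ℓ (x, y) → ¬ R x y →
          ∃ q, WythoffMove (x, y) q ∧ (IsTerminal ℓ q ∨ R q.1 q.2) := by
        intro x y hxy hnt hnR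
        simp only [IsTerminal] at hnt
        by_cases hx : x ≤ ℓ
        · exact ⟨(x, 0), ⟨y, by omega, by simp⟩, Or.inl (by simpa [IsTerminal] using hx)⟩
        rcases hcover x (by omega) with ⟨n, rfl⟩ | ⟨n, rfl⟩
        · rcases lt_trichotomy y (b n) with hlt | rfl | hgt
          · by_cases hd : y - a n ≤ ℓ
            · exact ⟨(0, y - a n), ⟨a n, by omega, by simp; omega⟩,
                Or.inl (by simpa [IsTerminal] using hd)⟩
            · obtain ⟨m, hm⟩ : ∃ m, y = a n + m + ℓ + 1 := ⟨y - a n - ℓ - 1, by omega⟩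
              have hmn : m < n := by
                have := hb n
                omega
              have := ha hmn
              have := hb m
              exact ⟨(a m, b m), ⟨a n - a m, by omega, by simp only; omega⟩,
                Or.inr ⟨m, Or.inl ⟨rfl, rfl⟩⟩⟩
          · exact absurd ⟨n, Or.inl ⟨rfl, rfl⟩⟩ hnR
          · exact ⟨(a n, b n), ⟨y - b n, by omega, Or.inr (Or.inl ⟨rfl, by simp only; omega⟩)⟩,
              Or.inr ⟨n, Or.inl ⟨rfl, rfl⟩⟩⟩
        · have := hb n
          exact ⟨(b n, a n), ⟨y - a n, by omega, Or.inr (Or.inl ⟨rfl, by simp only; omega⟩)⟩,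
            Or.inr ⟨n, Or.inr ⟨rfl, rfl⟩⟩⟩
      rintro ⟨x, y⟩ hp
      obtain ⟨hnt, hnR⟩ := not_or.1 hp
      rcases le_total x y with hxy | hxy
      · obtain ⟨q, hmove, hq⟩ := hle x y hxy hnt hnR
        exact ⟨q, ⟨hnt, hmove⟩, hq⟩
      · obtain ⟨⟨x', y'⟩, ⟨k, hk, hmove⟩, hq⟩ := hle y x hxy
          (by simpa [IsTerminal, add_comm] using hnt) (fun h => hnR (hRsymm _ _ h))
        refine ⟨(y', x'), ⟨hnt, k, hk, ?_⟩, ?_⟩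
        · simp only at hmove ⊢
          tauto
        · refine hq.imp (fun h => ?_) (fun h => hRsymm _ _ h)
          simpa [IsTerminal, add_comm] using h
  refine ⟨ha, hbmono, fun n => by have := hb n; omega, fun x y => ?_⟩
  rw [key]
  constructor
  · rintro ⟨h | h, hnt⟩
    · exact absurd h hnt
    · exact h
  · exact fun h => ⟨Or.inr h, hRnot x y h⟩

/-! ### Fixed points of morphisms -/

section Morphism

variable {A : Type} {μ : A → List A} {w : ℕ → A}

/-- The factor `w_n w_{n+1} ⋯ w_{n+r-1}` of length `r` of the infinite word `w`. -/
def wordFactor (w : ℕ → A) (n r : ℕ) : List A :=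
  (List.range r).map fun i => w (n + i)

@[simp] theorem length_wordFactor (n r : ℕ) : (wordFactor w n r).length = r := by
  simp [wordFactor]

theorem wordFactor_add (n r t : ℕ) :
    wordFactor w n (r + t) = wordFactor w n r ++ wordFactor w (n + r) t := by
  simp [wordFactor, List.range_add, Function.comp_def, add_assoc]

theorem take_wordFactor (w : ℕ → A) (n : ℕ) {i r : ℕ} (h : i ≤ r) :
    (wordFactor w n r).take i = wordFactor w n i := by
  rw [← Nat.add_sub_cancel' h, wordFactor_add, List.take_left' (by simp)]

theorem take_drop_wordFactor (w : ℕ → A) (n : ℕ) {d i r : ℕ} (h : d + i ≤ r) :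
    ((wordFactor w n r).drop d).take i = wordFactor w (n + d) i := by
  obtain ⟨t, rfl⟩ := Nat.exists_eq_add_of_le h
  rw [add_assoc, wordFactor_add, List.drop_left' (by simp), take_wordFactor _ _ (by omega)]

theorem getD_wordFactor (w : ℕ → A) (n : ℕ) {i r : ℕ} (h : i < r) (c : A) :
    (wordFactor w n r).getD i c = w (n + i) := by
  simp [wordFactor, h]

/-- The length of the image under `μ` of the prefix of length `n` of `w`. When `w` is a fixed
point, this is the index in `w` at which the image of the letter `w n` starts. -/
def imageIndex (μ : A → List A) (w : ℕ → A) (n : ℕ) : ℕ :=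
  ((wordFactor w 0 n).flatMap μ).length

theorem imageIndex_zero : imageIndex μ w 0 = 0 := by
  simp [imageIndex, wordFactor]

theorem imageIndex_add (n r : ℕ) :
    imageIndex μ w (n + r) = imageIndex μ w n + ((wordFactor w n r).flatMap μ).length := by
  simp only [imageIndex, wordFactor_add, List.flatMap_append, List.length_append, zero_add]

theorem imageIndex_succ (n : ℕ) :
    imageIndex μ w (n + 1) = imageIndex μ w n + (μ (w n)).length := by
  rw [imageIndex_add]
  simp [wordFactor]

theorem IsFixedPoint.flatMap_wordFactor (h : IsFixedPoint μ w) (n r : ℕ) :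
    (wordFactor w n r).flatMap μ =
      wordFactor w (imageIndex μ w n) ((wordFactor w n r).flatMap μ).length := by
  have hpre : ∀ m, (wordFactor w 0 m).flatMap μ = wordFactor w 0 (imageIndex μ w m) := fun m => by
    have := h.1 m
    simpa [IsPrefixOfWord, wordFactor, imageIndex] using this
  have h1 := hpre (n + r)
  rw [imageIndex_add, wordFactor_add, wordFactor_add, List.flatMap_append, zero_add, zero_add] at h1
  exact (List.append_inj h1 (by simp [imageIndex])).2

theorem IsFixedPoint.apply_letter (h : IsFixedPoint μ w) (n : ℕ) :
    μ (w n) = wordFactor w (imageIndex μ w n) (μ (w n)).length := by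
  have := h.flatMap_wordFactor n 1
  simpa [wordFactor] using this

/-! ### The infinite word `μ^ω(c)` -/

theorem iterate_flatMap_append (k : ℕ) (u v : List A) :
    (fun u : List A => u.flatMap μ)^[k] (u ++ v) =
      (fun u : List A => u.flatMap μ)^[k] u ++ (fun u : List A => u.flatMap μ)^[k] v := by
  induction k generalizing u v with
  | zero => rfl
  | succ k ih => simp only [Function.iterate_succ_apply, List.flatMap_append, ih]

theorem length_le_length_flatMap (hμ : ∀ d, μ d ≠ []) (u : List A) :
    u.length ≤ (u.flatMap μ).length := by
  induction u with
  | nil => simp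
  | cons d u ih =>
    have := List.length_pos_of_ne_nil (hμ d)
    simp only [List.flatMap_cons, List.length_append, List.length_cons]
    omega

theorem length_le_length_iterate_flatMap (hμ : ∀ d, μ d ≠ []) (k : ℕ) (u : List A) :
    u.length ≤ ((fun u : List A => u.flatMap μ)^[k] u).length := by
  induction k with
  | zero => rfl
  | succ k ih =>
    rw [Function.iterate_succ_apply']
    exact ih.trans (length_le_length_flatMap hμ _)

theorem iterMorphism_succ (k : ℕ) (c : A) :
    iterMorphism μ (k + 1) c = (iterMorphism μ k c).flatMap μ := by
  simp only [iterMorphism, Function.iterate_succ_apply']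

variable {c : A} {v : List A}

theorem iterMorphism_succ_eq_append (hc : μ c = c :: v) (k : ℕ) :
    iterMorphism μ (k + 1) c = iterMorphism μ k c ++ (fun u : List A => u.flatMap μ)^[k] v := by
  simp only [iterMorphism, Function.iterate_succ_apply]
  rw [← iterate_flatMap_append]
  simp [hc]

theorem iterMorphism_prefix (hc : μ c = c :: v) {j k : ℕ} (h : j ≤ k) :
    iterMorphism μ j c <+: iterMorphism μ k c := by
  induction h with
  | refl => exact List.prefix_rfl
  | step _ ih =>
    exact ih.trans (by rw [iterMorphism_succ_eq_append hc]; exact List.prefix_append _ _)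

theorem lt_length_iterMorphism (hμ : ∀ d, μ d ≠ []) (hc : μ c = c :: v) (hv : v ≠ []) (k : ℕ) :
    k < (iterMorphism μ k c).length := by
  induction k with
  | zero => simp [iterMorphism]
  | succ k ih =>
    have h1 := length_le_length_iterate_flatMap hμ k v
    have h2 := List.length_pos_of_ne_nil hv
    rw [iterMorphism_succ_eq_append hc, List.length_append]
    omega

theorem getElem?_iterMorphism (hμ : ∀ d, μ d ≠ []) (hc : μ c = c :: v) (hv : v ≠ []) {k i : ℕ}
    (hi : i < (iterMorphism μ k c).length) :
    (iterMorphism μ k c)[i]? = some (omegaWord μ c i) := by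
  have hi' := lt_length_iterMorphism hμ hc hv i
  have h1 : (iterMorphism μ i c)[i]? = some (omegaWord μ c i) := by
    simp [omegaWord, hi']
  rcases le_total k i with h | h
  · rw [← h1]
    simpa [hi, hi'] using (iterMorphism_prefix hc h).getElem hi
  · rw [← h1]
    simpa [hi, hi'] using ((iterMorphism_prefix hc h).getElem hi').symm

theorem isPrefixOfWord_of_prefix_iterMorphism (hμ : ∀ d, μ d ≠ []) (hc : μ c = c :: v)
    (hv : v ≠ []) {k : ℕ} {u : List A} (hu : u <+: iterMorphism μ k c) :
    IsPrefixOfWord u (omegaWord μ c) := by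
  apply List.ext_getElem?
  intro i
  by_cases hi : i < u.length
  · have hi' := hi.trans_le hu.length_le
    have h1 := getElem?_iterMorphism hμ hc hv hi'
    have h2 := hu.getElem hi
    rw [List.getElem?_eq_getElem hi'] at h1
    rw [List.getElem?_eq_getElem hi, h2, h1]
    simp [hi]
  · simp [hi]

theorem isFixedPoint_omegaWord (hμ : ∀ d, μ d ≠ []) (hc : μ c = c :: v) (hv : v ≠ []) :
    IsFixedPoint μ (omegaWord μ c) := by
  constructor
  · intro n
    have hn := lt_length_iterMorphism hμ hc hv n
    have htake : (List.range n).map (omegaWord μ c) = (iterMorphism μ n c).take n := by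
      have := isPrefixOfWord_of_prefix_iterMorphism hμ hc hv
        (List.take_prefix n (iterMorphism μ n c))
      rw [IsPrefixOfWord, List.length_take, min_eq_left hn.le] at this
      exact this.symm
    apply isPrefixOfWord_of_prefix_iterMorphism hμ hc hv (k := n + 1)
    rw [htake, iterMorphism_succ]
    conv_rhs => rw [← List.take_append_drop n (iterMorphism μ n c), List.flatMap_append]
    exact List.prefix_append _ _
  · intro m
    refine ⟨m, ?_⟩
    have := length_le_length_flatMap hμ ((List.range m).map (omegaWord μ c))
    simpa using this

end Morphism

/-! ### The fixed points of `μ₃` and the golden ratio -/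

theorem flatMap_flatMap_mu3_length (u : List (Fin 12)) :
    ((u.flatMap mu3).flatMap mu3).length = (u.flatMap mu3).length + u.length := by
  have hletter : ∀ c, ((mu3 c).flatMap mu3).length = (mu3 c).length + 1 := by decide
  induction u with
  | nil => rfl
  | cons c u ih =>
    simp only [List.flatMap_cons, List.flatMap_append, List.length_append, List.length_cons, ih,
      hletter]
    omega

theorem mu3_ne_nil (c : Fin 12) : mu3 c ≠ [] := by
  revert c
  decide

theorem length_mu3 (c : Fin 12) : (mu3 c).length = 1 ∨ (mu3 c).length = 2 := by
  revert c
  decide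

section FixedPoint

variable {w : ℕ → Fin 12}

theorem IsFixedPoint.imageIndex_imageIndex (h : IsFixedPoint mu3 w) (n : ℕ) :
    imageIndex mu3 w (imageIndex mu3 w n) = imageIndex mu3 w n + n := by
  have h1 := h.flatMap_wordFactor 0 n
  rw [imageIndex_zero] at h1
  have h2 := flatMap_flatMap_mu3_length (wordFactor w 0 n)
  rw [length_wordFactor, h1, length_wordFactor] at h2
  exact h2

theorem IsFixedPoint.mu3_apply (h : IsFixedPoint mu3 w) (n : ℕ) :
    mu3 (w n) = [w (imageIndex mu3 w n)] ∨
      mu3 (w n) = [w (imageIndex mu3 w n), w (imageIndex mu3 w n + 1)] := by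
  have h1 := h.apply_letter n
  rcases length_mu3 (w n) with h2 | h2
  · rw [h2] at h1
    exact Or.inl (by simpa [wordFactor] using h1)
  · rw [h2] at h1
    exact Or.inr (by simpa [wordFactor, List.range_succ] using h1)

/-- The first letter of an image under `μ₃` has an image of length two. -/
theorem IsFixedPoint.length_mu3_imageIndex (h : IsFixedPoint mu3 w) (n : ℕ) :
    (mu3 (w (imageIndex mu3 w n))).length = 2 := by
  have hletter : ∀ c d, (mu3 c).head? = some d → (mu3 d).length = 2 := by decide
  apply hletter (w n)
  rcases h.mu3_apply n with h1 | h1 <;> rw [h1] <;> rfl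

/-- The second letter of an image under `μ₃` has an image of length one. -/
theorem IsFixedPoint.length_mu3_imageIndex_add_one (h : IsFixedPoint mu3 w) {n : ℕ}
    (hn : (mu3 (w n)).length = 2) : (mu3 (w (imageIndex mu3 w n + 1))).length = 1 := by
  have hletter : ∀ c d, (mu3 c)[1]? = some d → (mu3 d).length = 1 := by decide
  apply hletter (w n)
  rcases h.mu3_apply n with h1 | h1
  · simp [h1] at hn
  · rw [h1]
    rfl

theorem IsFixedPoint.imageIndex_imageIndex_add_one (h : IsFixedPoint mu3 w) (n : ℕ) :
    imageIndex mu3 w (imageIndex mu3 w n + 1) = imageIndex mu3 w n + n + 2 := by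
  rw [imageIndex_succ, h.imageIndex_imageIndex, h.length_mu3_imageIndex]

/-- Every letter of the fixed point lies in the image of a letter. -/
theorem exists_imageIndex_eq (w : ℕ → Fin 12) (n : ℕ) :
    ∃ j, n = imageIndex mu3 w j ∨ (n = imageIndex mu3 w j + 1 ∧ (mu3 (w j)).length = 2) := by
  induction n with
  | zero => exact ⟨0, Or.inl imageIndex_zero.symm⟩
  | succ n ih =>
    obtain ⟨j, rfl | ⟨rfl, hj⟩⟩ := ih
    · rcases length_mu3 (w j) with hj | hj
      · exact ⟨j + 1, Or.inl (by rw [imageIndex_succ, hj])⟩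
      · exact ⟨j, Or.inr ⟨rfl, hj⟩⟩
    · exact ⟨j + 1, Or.inl (by rw [imageIndex_succ, hj])⟩

theorem IsFixedPoint.lt_imageIndex (h : IsFixedPoint mu3 w) {n : ℕ} (hn : 0 < n) :
    n < imageIndex mu3 w n := by
  induction n, hn using Nat.le_induction with
  | base =>
    have := h.length_mu3_imageIndex 0
    rw [imageIndex_zero] at this
    simp [imageIndex_succ, imageIndex_zero, this]
  | succ n _ ih =>
    have := length_mu3 (w n)
    rw [imageIndex_succ]
    omega

/-- Strong induction along the structure of a fixed point: from the index `j` of a letter to the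
indices of the letters of its image. -/
theorem IsFixedPoint.induction_imageIndex (h : IsFixedPoint mu3 w) {P : ℕ → Prop} (zero : P 0)
    (one : P 1) (first : ∀ j, 0 < j → P j → P (imageIndex mu3 w j))
    (second : ∀ j, 0 < j → (mu3 (w j)).length = 2 → P j → P (imageIndex mu3 w j + 1)) (n : ℕ) :
    P n := by
  induction n using Nat.strong_induction_on with
  | _ n ih =>
    obtain ⟨j, hj⟩ := exists_imageIndex_eq w n
    rcases Nat.eq_zero_or_pos j with rfl | hpos
    · rw [imageIndex_zero] at hj
      rcases hj with rfl | ⟨rfl, -⟩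
      exacts [zero, one]
    · have := h.lt_imageIndex hpos
      rcases hj with rfl | ⟨rfl, h2⟩
      · exact first j hpos (ih j this)
      · exact second j hpos h2 (ih j (by omega))

theorem IsFixedPoint.imageIndex_bounds (h : IsFixedPoint mu3 w) (n : ℕ) :
    (imageIndex mu3 w n : ℝ) + 1 < (n + 1) * Real.goldenRatio ∧
      (n + 1) * Real.goldenRatio < imageIndex mu3 w n + 2 := by
  have hsq := Real.goldenRatio_sq
  have h1 := Real.one_lt_goldenRatio
  have h2 := Real.goldenRatio_lt_two
  -- for `δ = (j + 1) φ - (s + 1)`, the equation `φ² = φ + 1` gives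
  -- `(s + 1) φ = s + j + 2 - δ (φ - 1)`
  have hstep : ∀ s j : ℝ, s + 1 < (j + 1) * Real.goldenRatio →
      (j + 1) * Real.goldenRatio < s + 2 →
      s + j + 3 - Real.goldenRatio < (s + 1) * Real.goldenRatio ∧
        (s + 1) * Real.goldenRatio < s + j + 2 := by
    intro s j hs hs'
    have heq : (s + 1) * Real.goldenRatio =
        s + j + 2 - ((j + 1) * Real.goldenRatio - (s + 1)) * (Real.goldenRatio - 1) := by
      linear_combination (j + 1) * hsq
    constructor <;> nlinarith
  induction n using h.induction_imageIndex with
  | zero =>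
    rw [imageIndex_zero]
    norm_num
    exact ⟨h1, h2⟩
  | one =>
    have := h.length_mu3_imageIndex 0
    rw [imageIndex_zero] at this
    rw [imageIndex_succ, imageIndex_zero, this]
    push_cast
    constructor <;> nlinarith
  | first j hj ih =>
    rw [h.imageIndex_imageIndex]
    have := hstep (imageIndex mu3 w j) j ih.1 ih.2
    push_cast
    constructor <;> linarith
  | second j hj hlen ih =>
    rw [h.imageIndex_imageIndex_add_one]
    have := hstep (imageIndex mu3 w j) j ih.1 ih.2
    push_cast
    constructor <;> linarith

theorem IsFixedPoint.floor_mul_goldenRatio (h : IsFixedPoint mu3 w) (n : ℕ) :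
    ⌊((n : ℝ) + 1) * Real.goldenRatio⌋ = (imageIndex mu3 w n : ℤ) + 1 := by
  have := h.imageIndex_bounds n
  rw [Int.floor_eq_iff]
  push_cast
  constructor <;> linarith

/-! ### Fibonacci representations and the fixed points of `μ₃` -/

theorem fibVal_append (u v : List (Fin 2)) :
    fibVal (u ++ v) = fibVal (u ++ List.replicate v.length 0) + fibVal v := by
  have hzero : ∀ m, fibVal (List.replicate m 0) = 0 := by
    intro m
    induction m with
    | zero => rfl
    | succ m ih => simp [List.replicate_succ, fibVal, ih]
  induction u with
  | nil => simp [hzero]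
  | cons d u ih => simp [fibVal, ih, add_assoc]

theorem fibVal_append_zero_zero (u : List (Fin 2)) :
    fibVal (u ++ [0] ++ [0]) = fibVal (u ++ [0]) + fibVal u := by
  induction u with
  | nil => rfl
  | cons d u ih =>
    simp only [List.cons_append, fibVal, List.length_append, List.length_singleton] at ih ⊢
    rw [ih, Nat.fib_add_two (n := u.length + 1 + 1)]
    ring_nf

theorem fibVal_append_one (u : List (Fin 2)) : fibVal (u ++ [1]) = fibVal (u ++ [0]) + 1 := by
  rw [fibVal_append]
  rfl

theorem fibVal_append_one_zero (u : List (Fin 2)) :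
    fibVal (u ++ [1] ++ [0]) = fibVal (u ++ [0] ++ [0]) + 2 := by
  rw [List.append_assoc, fibVal_append, List.append_assoc]
  rfl

/-- In any fixed point of `μ₃`, the image of the letter with index `u` starts at the index `u0`, and
it has length one exactly when `u` ends with `1`. Leading zeros of `u` are allowed. -/
theorem IsFixedPoint.imageIndex_fibVal (h : IsFixedPoint mu3 w) (u : List (Fin 2))
    (hu : u.IsChain fun d e => ¬ (d = 1 ∧ e = 1)) :
    imageIndex mu3 w (fibVal u) = fibVal (u ++ [0]) ∧
      ((mu3 (w (fibVal u))).length = 1 ↔ u.getLast? = some 1) := by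
  induction u using List.reverseRecOn with
  | nil =>
    have := h.length_mu3_imageIndex 0
    rw [imageIndex_zero] at this
    exact ⟨imageIndex_zero, by simp [fibVal, this]⟩
  | append_singleton u d ih =>
    rw [List.isChain_append] at hu
    obtain ⟨h1, h2⟩ := ih hu.1
    have hd : d = 0 ∨ d = 1 := by omega
    rcases hd with rfl | rfl
    · rw [fibVal_append_zero_zero, ← h1, h.imageIndex_imageIndex, h.length_mu3_imageIndex]
      simp
    · have hlast : u.getLast? ≠ some 1 := fun hl => hu.2.2 1 (by simp [hl]) 1 (by simp) ⟨rfl, rfl⟩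
      have hlen := (length_mu3 (w (fibVal u))).resolve_left (fun h => hlast (h2.1 h))
      rw [fibVal_append_one_zero, fibVal_append_zero_zero, fibVal_append_one, ← h1,
        h.imageIndex_imageIndex_add_one, h.length_mu3_imageIndex_add_one hlen]
      simp

theorem isPhiMorphism_mu3 : IsPhiMorphism mu3 := by
  refine ⟨⟨_, isFixedPoint_omegaWord mu3_ne_nil (c := 0) (v := [1]) rfl (by simp)⟩, ?_⟩
  rintro w h n u ⟨rfl, -, hu⟩
  obtain ⟨h1, h2⟩ := h.imageIndex_fibVal u hu
  rw [fibVal_append_one, ← h1]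
  rcases h.mu3_apply (fibVal u) with h3 | h3
  · exact ⟨fun _ => h3, fun hne => absurd (h2.1 (by rw [h3]; rfl)) hne⟩
  · exact ⟨fun hl => absurd (h2.2 hl) (by simp [h3]), fun _ => h3⟩

/-- The automaton with the letters as states, in which the digit `d` leads from the letter `c` to
the letter with index `d` of `μ₃ c`, computes the fixed point that starts with `0`. -/
theorem IsFixedPoint.isFibonacciAutomatic (h : IsFixedPoint mu3 w) (h0 : w 0 = 0)
    {B : Type} (ρ : Fin 12 → B) : IsFibonacciAutomatic fun n => ρ (w n) := by
  refine ⟨⟨Fin 12, inferInstance, 0, fun c d => (mu3 c).getD d 0, ρ⟩, ?_⟩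
  rintro n u ⟨rfl, -, hu⟩
  refine congrArg ρ ?_
  change u.foldl (fun c (d : Fin 2) => (mu3 c).getD d 0) 0 = w (fibVal u)
  induction u using List.reverseRecOn with
  | nil => exact h0.symm
  | append_singleton u d ih =>
    rw [List.isChain_append] at hu
    rw [List.foldl_append, ih hu.1]
    obtain ⟨h1, h2⟩ := h.imageIndex_fibVal u hu.1
    have hd : d = 0 ∨ d = 1 := by omega
    rcases hd with rfl | rfl
    · rw [← h1]
      rcases h.mu3_apply (fibVal u) with h3 | h3 <;> simp [h3]
    · have hlast : u.getLast? ≠ some 1 := fun hl => hu.2.2 1 (by simp [hl]) 1 (by simp) ⟨rfl, rfl⟩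
      rw [fibVal_append_one, ← h1]
      rcases h.mu3_apply (fibVal u) with h3 | h3
      · exact absurd (h2.1 (by rw [h3]; rfl)) hlast
      · simp [h3]

end FixedPoint

/-! ### The complementary sequences defined by `ρ₃` -/

/-- The factors of length three of `μ₃^ω(0)` at positive indices. -/
def mu3Factors : List (List (Fin 12)) :=
  [[1, 2, 3], [2, 3, 4], [3, 4, 5], [4, 5, 6], [5, 6, 7], [6, 7, 7], [7, 7, 8], [7, 8, 9],
   [8, 9, 10], [9, 10, 11], [10, 11, 10], [11, 10, 11], [11, 10, 5], [10, 5, 6], [5, 6, 10],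
   [6, 10, 11], [10, 11, 7], [11, 7, 10], [7, 10, 11], [11, 7, 8]]

theorem IsFixedPoint.wordFactor_one_four {w : ℕ → Fin 12} (h : IsFixedPoint mu3 w)
    (h0 : w 0 = 0) : wordFactor w 1 4 = [1, 2, 3, 4] := by
  have himage : ∀ u, wordFactor w 0 u.length = u →
      wordFactor w 0 (u.flatMap mu3).length = u.flatMap mu3 := by
    intro u hu
    have := h.flatMap_wordFactor 0 u.length
    rw [hu, imageIndex_zero] at this
    exact this.symm
  have h5 : wordFactor w 0 5 = [0, 1, 2, 3, 4] :=
    himage _ (himage _ (himage [0] (by simp [wordFactor, h0])))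
  have := take_drop_wordFactor w 0 (d := 1) (i := 4) (r := 5) (by omega)
  rw [h5] at this
  exact this.symm

theorem wordFactor_mem_mu3Factors {w : ℕ → Fin 12} (h : IsFixedPoint mu3 w) (h0 : w 0 = 0)
    {n : ℕ} (hn : 0 < n) : wordFactor w n 3 ∈ mu3Factors := by
  have hclosed : ∀ x ∈ mu3Factors, 4 ≤ (x.flatMap mu3).length ∧
      ((x.flatMap mu3).drop 0).take 3 ∈ mu3Factors ∧
      ((mu3 (x.getD 0 0)).length = 2 → ((x.flatMap mu3).drop 1).take 3 ∈ mu3Factors) := by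
    decide
  have himage : ∀ j, wordFactor w j 3 ∈ mu3Factors →
      wordFactor w (imageIndex mu3 w j) 3 ∈ mu3Factors ∧
      ((mu3 (w j)).length = 2 → wordFactor w (imageIndex mu3 w j + 1) 3 ∈ mu3Factors) := by
    intro j hj
    obtain ⟨hlen, hfst, hsnd⟩ := hclosed _ hj
    rw [getD_wordFactor _ _ (by omega), add_zero] at hsnd
    rw [h.flatMap_wordFactor j 3] at hfst hsnd
    rw [take_drop_wordFactor _ _ (by omega)] at hfst hsnd
    exact ⟨hfst, hsnd⟩
  induction n using h.induction_imageIndex with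
  | zero => exact absurd hn (lt_irrefl 0)
  | one =>
    have := take_wordFactor w 1 (i := 3) (r := 4) (by omega)
    rw [h.wordFactor_one_four h0] at this
    rw [← this]
    decide
  | first j hj ih => exact (himage j (ih hj)).1
  | second j hj hlen ih => exact (himage j (ih hj)).2 hlen

/-- The sequence `s m + g m`, where `s` is `imageIndex` and `g m = ρ₃ (w m)`; its terms with
`m > 0` are the smaller coordinates of the non-terminal `P`-positions of `K³` when `w = μ₃^ω(0)`.
The larger ones are `s m + g m + m + 3`. -/
def lowerCoord (w : ℕ → Fin 12) (m : ℕ) : ℕ := imageIndex mu3 w m + (rho3 (w m) : ℕ)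

/-- The difference between `lowerCoord w (m + i)` and `imageIndex mu3 w m`, computed from a factor
`x` of `w` that starts at the index `m`. -/
def lowerOffset (x : List (Fin 12)) (i : ℕ) : ℕ :=
  ((x.take i).flatMap mu3).length + (rho3 (x.getD i 0) : ℕ)

theorem lowerCoord_add (w : ℕ → Fin 12) (m : ℕ) {i r : ℕ} (h : i < r) :
    lowerCoord w (m + i) = imageIndex mu3 w m + lowerOffset (wordFactor w m r) i := by
  rw [lowerCoord, lowerOffset, imageIndex_add, take_wordFactor _ _ h.le, getD_wordFactor _ _ h]
  omega

/-- With `A m = lowerCoord w m` and `B m = A m + m + 3`: the sequence `A` increases, `B m` lies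
strictly between two consecutive terms of `A`, and the numbers strictly between `B m` and
`B (m + 1)` are terms of `A`. All numbers involved are read off, relative to `s (s m)`, from the
factor of length three at `m` and its image, so this is a check of finitely many factors. -/
theorem lowerCoord_local {w : ℕ → Fin 12} (h : IsFixedPoint mu3 w) (h0 : w 0 = 0)
    {m : ℕ} (hm : 0 < m) :
    lowerCoord w m < lowerCoord w (m + 1) ∧
    (∃ i, 0 < i ∧ lowerCoord w i < lowerCoord w m + m + 3 ∧
      lowerCoord w m + m + 3 < lowerCoord w (i + 1)) ∧
    ∀ k, lowerCoord w m + m + 3 < k → k < lowerCoord w (m + 1) + (m + 1) + 3 →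
      ∃ i, 0 < i ∧ lowerCoord w i = k := by
  have hcheck : ∀ x ∈ mu3Factors, lowerOffset x 0 < lowerOffset x 1 ∧
      (∃ i < (x.flatMap mu3).length - 1, lowerOffset (x.flatMap mu3) i < lowerOffset x 0 + 3 ∧
        lowerOffset x 0 + 3 < lowerOffset (x.flatMap mu3) (i + 1)) ∧
      ∀ k < lowerOffset x 1 + 4, lowerOffset x 0 + 3 < k →
        ∃ i < (x.flatMap mu3).length, lowerOffset (x.flatMap mu3) i = k := by
    decide
  obtain ⟨hmono, ⟨i, hi, hi1, hi2⟩, hfill⟩ := hcheck _ (wordFactor_mem_mu3Factors h h0 hm)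
  have hx0 := lowerCoord_add w m (i := 0) (r := 3) (by omega)
  have hx1 := lowerCoord_add w m (i := 1) (r := 3) (by omega)
  have hss := h.imageIndex_imageIndex m
  have hpos := h.lt_imageIndex hm
  rw [h.flatMap_wordFactor m 3] at hi hi1 hi2 hfill
  simp only [length_wordFactor] at hi hfill
  have hy : ∀ i < ((wordFactor w m 3).flatMap mu3).length, lowerCoord w (imageIndex mu3 w m + i) =
      imageIndex mu3 w m + m + lowerOffset (wordFactor w (imageIndex mu3 w m)
        ((wordFactor w m 3).flatMap mu3).length) i := by
    intro i hi
    rw [← hss]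
    exact lowerCoord_add w _ hi
  rw [add_zero] at hx0
  refine ⟨by omega, ⟨imageIndex mu3 w m + i, by omega, ?_, ?_⟩, fun k hk1 hk2 => ?_⟩
  · rw [hy i (by omega)]
    omega
  · rw [add_assoc (imageIndex mu3 w m) i 1, hy (i + 1) (by omega)]
    omega
  · obtain ⟨i, hi, hik⟩ := hfill (k - (imageIndex mu3 w m + m)) (by omega) (by omega)
    refine ⟨imageIndex mu3 w m + i, by omega, ?_⟩
    rw [hy i hi]
    omega

theorem enumeratesNonterminalPPositions_lowerCoord {w : ℕ → Fin 12} (h : IsFixedPoint mu3 w)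
    (h0 : w 0 = 0) :
    EnumeratesNonterminalPPositions 3 (fun n => lowerCoord w (n + 1))
      (fun n => lowerCoord w (n + 1) + n + 3 + 1) := by
  have hmono : StrictMono fun n => lowerCoord w (n + 1) :=
    strictMono_nat_of_lt_succ fun n => (lowerCoord_local h h0 n.succ_pos).1
  -- the initial terms `A 1 = 4`, …, `A 4 = 7` precede `B 1 = 8`
  have hfac := h.wordFactor_one_four h0
  have hs1 : imageIndex mu3 w 1 = 2 := by
    rw [imageIndex_succ, imageIndex_zero, h0]
    rfl
  have hinit : ∀ i < 4, lowerCoord w (i + 1) = i + 4 := by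
    intro i hi
    rw [add_comm i 1, lowerCoord_add w 1 hi, hfac, hs1]
    interval_cases i <;> rfl
  apply enumeratesNonterminalPPositions_of_complementary hmono (fun n => rfl)
  · exact (hinit 0 (by omega)).ge
  · intro m n hmn
    obtain ⟨-, ⟨i, hi, hi1, hi2⟩, -⟩ := lowerCoord_local h h0 (Nat.add_one_pos n)
    obtain ⟨i, rfl⟩ : ∃ i', i = i' + 1 := ⟨i - 1, by omega⟩
    have h1 : lowerCoord w (i + 1) < lowerCoord w (m + 1) := by omega
    have h2 : lowerCoord w (m + 1) < lowerCoord w (i + 1 + 1) := by omega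
    have h3 := hmono.lt_iff_lt.1 h1
    have h4 := hmono.lt_iff_lt.1 h2
    omega
  · -- induction on the number of terms of `B` that are considered
    have hcover : ∀ N k, 4 ≤ k → k < lowerCoord w (N + 1) + N + 3 + 1 →
        (∃ n, k = lowerCoord w (n + 1)) ∨ ∃ n, k = lowerCoord w (n + 1) + n + 3 + 1 := by
      intro N
      induction N with
      | zero =>
        intro k hk hkN
        have := hinit 0 (by omega)
        have := hinit (k - 4) (by omega)
        exact Or.inl ⟨k - 4, by omega⟩
      | succ N ih =>
        intro k hk hkN
        obtain ⟨-, -, hfill⟩ := lowerCoord_local h h0 (Nat.add_one_pos N)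
        rcases lt_trichotomy k (lowerCoord w (N + 1) + N + 3 + 1) with hlt | heq | hgt
        · exact ih k hk hlt
        · exact Or.inr ⟨N, heq⟩
        · obtain ⟨i, hi, hik⟩ := hfill k (by omega) (by omega)
          exact Or.inl ⟨i - 1, by rw [Nat.sub_add_cancel hi, hik]⟩
    exact fun k hk => hcover k k hk (by omega)

theorem mainTheorem6 :
    IsPhiMorphism mu3 ∧
    IsFixedPoint mu3 (omegaWord mu3 0) ∧
    ∃ g : ℕ → Fin 3,
      (∀ n : ℕ, g n = rho3 (omegaWord mu3 0 n)) ∧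
      IsFibonacciAutomatic g ∧
      ∃ a b : ℕ → ℕ,
        EnumeratesNonterminalPPositions 3 a b ∧
        ∀ n : ℕ,
          (a n : ℤ) = ⌊((n : ℝ) + 2) * Real.goldenRatio⌋ + ((g (n + 1) : ℕ) : ℤ) - 1 ∧
          (b n : ℤ) = ⌊((n : ℝ) + 2) * Real.goldenRatio ^ 2⌋ + ((g (n + 1) : ℕ) : ℤ) + 1 := by
  have hfix : IsFixedPoint mu3 (omegaWord mu3 0) :=
    isFixedPoint_omegaWord mu3_ne_nil (v := [1]) rfl (by simp)
  refine ⟨isPhiMorphism_mu3, hfix, fun n => rho3 (omegaWord mu3 0 n), fun _ => rfl,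
    hfix.isFibonacciAutomatic rfl rho3, _, _, enumeratesNonterminalPPositions_lowerCoord hfix rfl,
    fun n => ?_⟩
  have hfloor := hfix.floor_mul_goldenRatio (n + 1)
  have hn : ((n + 1 : ℕ) : ℝ) + 1 = (n : ℝ) + 2 := by
    push_cast
    ring
  rw [hn] at hfloor
  have hsq : ((n : ℝ) + 2) * Real.goldenRatio ^ 2 =
      ((n : ℝ) + 2) * Real.goldenRatio + ((n + 2 : ℕ) : ℝ) := by
    rw [Real.goldenRatio_sq]
    push_cast
    ring
  rw [hsq, Int.floor_add_natCast, hfloor]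
  simp only [lowerCoord]
  push_cast
  constructor <;> ring
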